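/- Let $(S_x)_{x\in[0,1]}$ be a centered Gaussian process with continuous paths and $S_0=0$, whose covariance function $\Gamma(x,y)=\mathbb{E}[S_xS_y]$ is continuous on $[0,1]^2$ and non-degenerate on $(0,1]^2$ in the sense that, for all distinct $x,y\in(0,1]$, the covariance matrix of $(S_x,S_y)$ is invertible. Write $\gamma(x)=\Gamma(x,x)$. Suppose that, for some $\alpha_2>0$, $(S_{rx})_{x\in[0,1]}\stackrel{d}{=}(\sqrt{r}^{\,\alpha_2}S_x)_{x\in[0,1]}$ for all $r\in(0,1]$, and that $\mathbb{E}[S_1^2]=1$ (so that $\gamma(x)=x^{\alpha_2}$). Let $H(\Gamma)$ be the reproducing kernel Hilbert space of $\Gamma$, i.e. the completion of the space of finite linear combinations of the functions $\Gamma(x,\cdot)$, $x\in[0,1]$, under the inner product determined by $\langle\Gamma(x,\cdot),\Gamma(y,\cdot)\rangle=\Gamma(x,y)$, viewed as a space of functions on $[0,1]$, and let $K=\{\phi\in H(\Gamma):\langle\phi,\phi\rangle\le 1\}$. Let $\beta\in(0,\infty)$, put $\kappa_x=\beta\sqrt{\gamma(x)\,|\log|\log x||}$ (with $\kappa_0=0$;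 the value given to $\kappa_1$ is immaterial), and suppose that $S$ satisfies the following local functional law of the iterated logarithm: almost surely, there is an $r_0>0$ such that the family of paths $\xi^r=(S_{rx}/\kappa_r)_{x\in[0,1]}$, $r\in(0,r_0]$, is relatively compact in $C([0,1])$, and the set of its limit points as $r\downarrow0$ is equal to $K$. Then, almost surely, the following holds for every extension $f_0:(1,\infty)\to[0,1]$ for which the function $$f(x)=\begin{cases}(1+S_x-\kappa_x)_+\wedge 1,& x\in[0,1],\\ f_0(x),& x>1,\end{cases}$$ satisfies $\int_0^\infty f(x)\,\mathrm{d}x=1$ and $\int_0^\infty x f(x)\,\mathrm{d}x<\infty$: the density $f$ satisfies the averaging condition, that is, $f\le 1$, $\int_0^\infty xf(x)\,\mathrm{d}x<\infty$, and there exist a non-decreasing function $g:(0,\infty)\to(0,\infty)$ (extended by $g(0):=0$) and a $\lambda_0>0$ such that $$\int_\mu^{\mu+1}f(\lambda x)\,\mathrm{d}x\le 1-g\big(\lambda(\mu+1)\big)\qquad\text{for all }\lambda\in[0,\lambda_0)\text{ and }\mu\in[0,1].$$ -/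

import Mathlib

open MeasureTheory ProbabilityTheory Set Filter Topology unitInterval

noncomputable section

/-- The covariance function `Γ(x, y) = E[S_x S_y]` of a centered process with continuous paths
indexed by `[0, 1]`. A path of the process is an element of `C([0, 1])`. -/
def covFun {Ω : Type*} [MeasurableSpace Ω] (S : Ω → C(I, ℝ)) (P : Measure Ω) (x y : I) : ℝ :=
  ∫ ω, S ω x * S ω y ∂P

/-- A real-valued kernel on `[0, 1]` as an operator-valued matrix, the form in which Mathlib
takes reproducing kernels. -/
def kernelMatrix (Γ : I → I → ℝ) : Matrix I I (ℝ →L[ℝ] ℝ) :=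
  Matrix.of fun x y => Γ x y • (1 : ℝ →L[ℝ] ℝ)

/-- The covariance function of a Gaussian process is a positive semidefinite kernel. -/
theorem posSemidef_kernelMatrix_covFun {Ω : Type*} [MeasurableSpace Ω] {S : Ω → C(I, ℝ)}
    {P : Measure Ω} (hS : IsGaussianProcess (fun x ω => S ω x) P) :
    (kernelMatrix (covFun S P)).PosSemidef := by
  have hint : ∀ x y : I, Integrable (fun ω => S ω x * S ω y) P := fun x y =>
    (hS.hasGaussianLaw_eval x).memLp_two.integrable_mul (hS.hasGaussianLaw_eval y).memLp_two
  have key := (RKHS.posSemidef_tfae (K := kernelMatrix (covFun S P))).out 0 2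
  refine key.mpr ⟨?_, fun v => ?_⟩
  · ext x y
    simp [kernelMatrix, covFun, mul_comm]
  · have h : (v.sum fun x w => v.sum fun x' w' =>
        inner ℝ (kernelMatrix (covFun S P) x' x w) w') =
        ∫ ω, (v.sum fun x w => w * S ω x) ^ 2 ∂P := by
      simp only [Finsupp.sum, sq, Finset.sum_mul_sum]
      rw [integral_finsetSum]
      · refine Finset.sum_congr rfl fun x _ => ?_
        rw [integral_finsetSum]
        · refine Finset.sum_congr rfl fun y _ => ?_
          have : ∀ ω, v x * S ω x * (v y * S ω y) = (v x * v y) * (S ω y * S ω x) :=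
            fun ω => by ring
          simp only [this, integral_const_mul]
          simp [kernelMatrix, covFun]
          ring
        · intro y _
          have : ∀ ω, v x * S ω x * (v y * S ω y) = (v x * v y) * (S ω x * S ω y) :=
            fun ω => by ring
          simp only [this]
          exact (hint x y).const_mul _
      · intro x _
        refine integrable_finsetSum _ fun y _ => ?_
        have : ∀ ω, v x * S ω x * (v y * S ω y) = (v x * v y) * (S ω x * S ω y) :=
          fun ω => by ring
        simp only [this]
        exact (hint x y).const_mul _
    rw [h]
    exact integral_nonneg fun ω => sq_nonneg _

/-- The closed unit ball `K` of the reproducing kernel Hilbert space `H(Γ)` (the completion of the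
span of the functions `Γ(x, ·)`), seen as a set of continuous functions on `[0, 1]`. -/
def rkhsUnitBall (Γ : I → I → ℝ) (hΓ : (kernelMatrix Γ).PosSemidef) : Set C(I, ℝ) :=
  haveI : Fact (kernelMatrix Γ).PosSemidef := ⟨hΓ⟩
  {φ | ∃ h : RKHS.OfKernel (kernelMatrix Γ), ‖h‖ ≤ 1 ∧ ∀ x : I, φ x = h x}

/-- `κ_x = β √(γ(x) |log |log x||)` with `γ(x) = Γ(x, x)`. -/
def kappa (Γ : I → I → ℝ) (β : ℝ) (x : I) : ℝ :=
  β * √(Γ x x * abs (Real.log (abs (Real.log x))))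

/-- The rescaled path `ξ^r = (s(r x) / κ_r)_{x ∈ [0, 1]}` of a path `s`. -/
def rescaledPath (Γ : I → I → ℝ) (β : ℝ) (s : C(I, ℝ)) (r : I) : C(I, ℝ) where
  toFun x := s (r * x) / kappa Γ β r
  continuous_toFun := by fun_prop

/-- The local functional law of the iterated logarithm with constant `β`: almost surely, the
rescaled paths `ξ^r`, for small `r > 0`, form a relatively compact set in `C([0, 1])`, and their
limit points as `r ↓ 0` are exactly the elements of the unit ball of `H(Γ)`.
Only small `r` are taken because `κ_r` vanishes at `r = 1 / e`. -/
def LocalFunctionalLIL {Ω : Type*} [MeasurableSpace Ω] (S : Ω → C(I, ℝ)) (P : Measure Ω)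
    (hS : IsGaussianProcess (fun x ω => S ω x) P) (β : ℝ) : Prop :=
  ∀ᵐ ω ∂P,
    (∃ r₀ : I, 0 < r₀ ∧
      IsCompact (closure (rescaledPath (covFun S P) β (S ω) '' Ioc 0 r₀))) ∧
    {φ : C(I, ℝ) | MapClusterPt φ (𝓝[>] (0 : I)) (rescaledPath (covFun S P) β (S ω))} =
      rkhsUnitBall (covFun S P) (posSemidef_kernelMatrix_covFun hS)

/-- The function equal to `(1 + s_x - κ_x)_+ ∧ 1` on `[0, 1]` and to `f₀` on `(1, ∞)`
(its values on the negative half-line play no role). -/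
def pathDensity (κ : I → ℝ) (s : C(I, ℝ)) (f₀ : ℝ → ℝ) (x : ℝ) : ℝ :=
  open Classical in
  if hx : x ∈ Icc (0 : ℝ) 1 then min (max (1 + s ⟨x, hx⟩ - κ ⟨x, hx⟩) 0) 1 else f₀ x

/-- The averaging condition on a probability density `f` on `[0, ∞)`. The function `g` is positive
and non-decreasing on `(0, ∞)`; it is given the value `0` at `0`, which is only used
for `lam = 0`. -/
def AveragingCondition (f : ℝ → ℝ) : Prop :=
  ∃ g : ℝ → ℝ, MonotoneOn g (Ioi 0) ∧ (∀ x, 0 < x → 0 < g x) ∧ g 0 = 0 ∧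
    (∀ x, 0 ≤ x → f x ≤ 1) ∧ IntegrableOn (fun x => x * f x) (Ioi 0) ∧
    ∃ lam₀ : ℝ, 0 < lam₀ ∧ ∀ lam ∈ Ico 0 lam₀, ∀ μ ∈ Icc (0 : ℝ) 1,
      ∫ x in μ..(μ + 1), f (lam * x) ≤ 1 - g (lam * (μ + 1))

end

/-! The density equals 1 at `x ∈ (0, 1]` only where `S_x ≥ κ_x`. Suppose this happens at both `r`
and `r / 2` for arbitrarily small `r`. By compactness `ξ^r` clusters along such `r` at some `φ ∈ K`.
Since `κ_{r/2} ≥ √γ(1/2) κ_r`, this `φ` satisfies `φ(1) ≥ 1` and `φ(1/2) ≥ √γ(1/2)`. By the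
reproducing property these are equality cases of Cauchy–Schwarz, so `Γ(1, ·)` and `Γ(1/2, ·)` are
multiples of the same vector, contradicting non-degeneracy (`eventually_not_kappa_le`).

Hence for all small `r` the function `1 - f` is positive somewhere on `[r/2, r]`, and by continuity
its integral there is positive. With `r = λ(μ + 1)` and `μ ≤ 1`, the averaging window `[λμ, r]`
contains `[r/2, r]`, which yields a positive continuous lower bound in `r`, and then a monotone one
(`exists_average_le_one_sub`). -/

section HilbertSpace

variable {H : Type*} [NormedAddCommGroup H] [InnerProductSpace ℝ H]

/-- The equality case of the Cauchy–Schwarz inequality for a vector of the closed unit ball. -/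
lemma eq_norm_smul_of_norm_le_inner {u h : H} (hh : ‖h‖ ≤ 1) (hu : ‖u‖ ≤ inner ℝ u h) :
    u = ‖u‖ • h := by
  rw [← sub_eq_zero, ← norm_eq_zero, ← sq_eq_zero_iff]
  refine le_antisymm ?_ (sq_nonneg _)
  rw [norm_sub_sq_real, inner_smul_right, norm_smul, norm_norm]
  have h1 : ‖u‖ * ‖u‖ ≤ ‖u‖ * inner ℝ u h := by gcongr
  have h2 : (‖u‖ * ‖h‖) ^ 2 ≤ ‖u‖ ^ 2 := by
    gcongr
    exact mul_le_of_le_one_right (norm_nonneg u) hh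
  nlinarith

/-- Both vectors are multiples of `h`, so their Gram determinant vanishes. -/
lemma inner_mul_inner_eq_of_norm_le_inner {u v h : H} (hh : ‖h‖ ≤ 1)
    (hu : ‖u‖ ≤ inner ℝ u h) (hv : ‖v‖ ≤ inner ℝ v h) :
    inner ℝ u u * inner ℝ v v = inner ℝ v u * inner ℝ u v := by
  rw [eq_norm_smul_of_norm_le_inner hh hu, eq_norm_smul_of_norm_le_inner hh hv]
  simp only [inner_smul_left, inner_smul_right]
  simp
  ring

end HilbertSpace

/-- A function of the unit ball of the reproducing kernel Hilbert space attains the bound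
`√Γ(x, x)` at two points only if the kernel is degenerate there. -/
lemma mul_eq_mul_of_mem_rkhsUnitBall {Γ : I → I → ℝ} {hΓ : (kernelMatrix Γ).PosSemidef}
    {φ : C(I, ℝ)} (hφ : φ ∈ rkhsUnitBall Γ hΓ) {x y : I}
    (hx : √(Γ x x) ≤ φ x) (hy : √(Γ y y) ≤ φ y) :
    Γ x x * Γ y y = Γ x y * Γ y x := by
  have : Fact (kernelMatrix Γ).PosSemidef := ⟨hΓ⟩
  obtain ⟨h, hh, hφh⟩ := hφ
  have hinner : ∀ z w : I, inner ℝ (RKHS.kerFun (RKHS.OfKernel (kernelMatrix Γ)) w 1)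
      (RKHS.kerFun (RKHS.OfKernel (kernelMatrix Γ)) z 1) = Γ z w := fun z w => by
    rw [← RKHS.kernel_inner, RKHS.OfKernel.kernel_ofKernel]
    simp [kernelMatrix]
  have hle : ∀ z : I, √(Γ z z) ≤ φ z →
      ‖RKHS.kerFun (RKHS.OfKernel (kernelMatrix Γ)) z 1‖ ≤
        inner ℝ (RKHS.kerFun (RKHS.OfKernel (kernelMatrix Γ)) z 1) h := fun z hz => by
    rw [norm_eq_sqrt_real_inner, hinner, RKHS.kerFun_inner, ← hφh]
    simpa using hz
  simpa only [hinner] using inner_mul_inner_eq_of_norm_le_inner hh (hle x hx) (hle y hy)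

/-! ### Averages of functions bounded by 1 -/

/-- Take the minimum of `D` over `[x, R]`: it is attained, hence positive, and grows as the interval
shrinks. Replacing `x` by `min x R` keeps the interval nonempty beyond `R`. -/
lemma exists_monotone_pos_le_of_continuousOn {D : ℝ → ℝ} {R : ℝ} (hR : 0 < R)
    (hD : ContinuousOn D (Ioc 0 R)) (hpos : ∀ r ∈ Ioc 0 R, 0 < D r) :
    ∃ g : ℝ → ℝ, MonotoneOn g (Ioi 0) ∧ (∀ x, 0 < x → 0 < g x) ∧ g 0 = 0 ∧
      ∀ r ∈ Ioc 0 R, g r ≤ D r := by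
  have hsub : ∀ x, 0 < x → Icc (min x R) R ⊆ Ioc 0 R := fun x hx y hy =>
    ⟨(lt_min hx hR).trans_le hy.1, hy.2⟩
  have hne : ∀ x : ℝ, (Icc (min x R) R).Nonempty := fun x => ⟨R, min_le_right _ _, le_rfl⟩
  have hmin : ∀ x, 0 < x → ∃ y ∈ Icc (min x R) R, IsMinOn D (Icc (min x R) R) y := fun x hx =>
    isCompact_Icc.exists_isMinOn (hne x) (hD.mono (hsub x hx))
  have hbdd : ∀ x, 0 < x → BddBelow (D '' Icc (min x R) R) := fun x hx => by
    refine ⟨0, ?_⟩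
    rintro _ ⟨y, hy, rfl⟩
    exact (hpos y (hsub x hx hy)).le
  refine ⟨fun x => if 0 < x then sInf (D '' Icc (min x R) R) else 0, ?_, ?_, by simp, ?_⟩
  · intro x hx y hy hxy
    simp only [mem_Ioi] at hx hy
    simp only [hx, hy, if_true]
    exact csInf_le_csInf (hbdd x hx) ((hne y).image D)
      (image_mono (Icc_subset_Icc_left (min_le_min_right R hxy)))
  · intro x hx
    simp only [hx, if_true]
    obtain ⟨y, hy, hyD⟩ := hmin x hx
    refine (hpos y (hsub x hx hy)).trans_le (le_csInf ((hne x).image D) ?_)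
    rintro _ ⟨z, hz, rfl⟩
    exact hyD hz
  · intro r hr
    simp only [hr.1, if_true]
    exact csInf_le (hbdd r hr.1) ⟨r, ⟨min_le_left _ _, hr.2⟩, rfl⟩

/-- A function with values in `[0, 1]` that is continuous on `(0, R]` and is not identically `1`
on any of the intervals `[r / 2, r]` has averages that are bounded away from `1`. -/
lemma exists_average_le_one_sub {f : ℝ → ℝ} {R : ℝ} (hR : 0 < R)
    (hf : ContinuousOn f (Ioc 0 R)) (hf0 : ∀ x, 0 ≤ x → x ≤ R → 0 ≤ f x)
    (hf1 : ∀ x, 0 ≤ x → x ≤ R → f x ≤ 1)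
    (hlt : ∀ r ∈ Ioc 0 R, ∃ c ∈ Icc (r / 2) r, f c < 1) :
    ∃ g : ℝ → ℝ, MonotoneOn g (Ioi 0) ∧ (∀ x, 0 < x → 0 < g x) ∧ g 0 = 0 ∧
      ∀ lam ∈ Ico 0 (R / 2), ∀ μ ∈ Icc (0 : ℝ) 1,
        ∫ x in μ..(μ + 1), f (lam * x) ≤ 1 - g (lam * (μ + 1)) := by
  have hint : IntervalIntegrable f volume 0 R := by
    rw [intervalIntegrable_iff_integrableOn_Ioc_of_le hR.le]
    refine ⟨hf.aestronglyMeasurable measurableSet_Ioc,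
      .restrict_of_bounded (C := 1) measure_Ioc_lt_top ?_⟩
    filter_upwards [ae_restrict_mem measurableSet_Ioc] with x hx
    rw [Real.norm_of_nonneg (hf0 x hx.1.le hx.2)]
    exact hf1 x hx.1.le hx.2
  have hsub : ∀ a b, 0 ≤ a → a ≤ b → b ≤ R → IntervalIntegrable (fun x => 1 - f x) volume a b :=
    fun a b ha hab hb => by
      refine intervalIntegrable_const.sub (hint.mono_set ?_)
      rw [uIcc_of_le hab, uIcc_of_le hR.le]
      exact Icc_subset_Icc ha hb
  set F : ℝ → ℝ := fun r => ∫ x in (0 : ℝ)..r, (1 - f x) with hF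
  have hFc : ContinuousOn F (Icc 0 R) := by
    have := intervalIntegral.continuousOn_primitive_interval'
      (hsub 0 R le_rfl hR.le le_rfl) left_mem_uIcc
    rwa [uIcc_of_le hR.le] at this
  have hFsub : ∀ a b, 0 ≤ a → a ≤ b → b ≤ R → F b - F a = ∫ x in a..b, (1 - f x) :=
    fun a b ha hab hb => intervalIntegral.integral_interval_sub_left
      (hsub 0 b le_rfl (ha.trans hab) hb) (hsub 0 a le_rfl ha (hab.trans hb))
  -- Dividing by `r = λ(μ + 1)` instead of `λ` makes the bound a function of `r` alone; it only
  -- weakens it, as `λ ≤ r`.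
  obtain ⟨g, hgm, hgp, hg0, hgD⟩ := exists_monotone_pos_le_of_continuousOn
      (D := fun r => (F r - F (r / 2)) / r) hR
    (by
      refine ContinuousOn.div ((hFc.mono Ioc_subset_Icc_self).sub
        (hFc.comp (by fun_prop) fun r hr => ?_)) continuousOn_id fun r hr => hr.1.ne'
      exact ⟨by linarith [hr.1], by linarith [hr.1, hr.2]⟩)
    (by
      intro r hr
      have h1 : 0 ≤ r / 2 := by linarith [hr.1]
      have h2 : r / 2 < r := by linarith [hr.1]
      refine div_pos ?_ hr.1
      rw [hFsub (r / 2) r h1 h2.le hr.2]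
      refine intervalIntegral.integral_pos h2 ?_ ?_ ?_
      · exact continuousOn_const.sub (hf.mono fun x hx =>
          ⟨by linarith [hx.1, hr.1], hx.2.trans hr.2⟩)
      · exact fun x hx => sub_nonneg.2 (hf1 x (h1.trans hx.1.le) (hx.2.trans hr.2))
      · obtain ⟨c, hc, hcf⟩ := hlt r hr
        exact ⟨c, hc, sub_pos.2 hcf⟩)
  refine ⟨g, hgm, hgp, hg0, fun lam hlam μ hμ => ?_⟩
  rcases hlam.1.eq_or_lt with rfl | hpos
  · simpa [hg0] using hf1 0 le_rfl hR.le
  · have hr : lam * (μ + 1) ∈ Ioc 0 R :=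
      ⟨by nlinarith [hμ.1], by nlinarith [hμ.1, hμ.2, hlam.2]⟩
    have h1 : 0 ≤ lam * μ := mul_nonneg hpos.le hμ.1
    have h2 : lam * μ ≤ lam * (μ + 1) := by nlinarith
    -- Here `μ ≤ 1` places `[r/2, r]` inside the averaging window.
    have h3 : lam * μ ≤ lam * (μ + 1) / 2 := by nlinarith [hμ.2]
    have hdef : ∫ x in μ..(μ + 1), (1 - f (lam * x)) =
        lam⁻¹ * ∫ x in (lam * μ)..(lam * (μ + 1)), (1 - f x) :=
      intervalIntegral.integral_comp_mul_left (fun x => 1 - f x) hpos.ne'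
    have hsplit : ∫ x in μ..(μ + 1), f (lam * x) = 1 - ∫ x in μ..(μ + 1), (1 - f (lam * x)) := by
      have hi : IntervalIntegrable (fun x => 1 - f (lam * x)) volume μ (μ + 1) := by
        have := (hsub _ _ h1 h2 hr.2).comp_mul_left (c := lam)
        simpa [hpos.ne'] using this
      rw [eq_sub_iff_add_eq, ← intervalIntegral.integral_add _ hi]
      · simp
      · simpa using (intervalIntegrable_const (c := (1 : ℝ))).sub hi
    have hmono : ∫ x in (lam * (μ + 1) / 2)..(lam * (μ + 1)), (1 - f x) ≤
        ∫ x in (lam * μ)..(lam * (μ + 1)), (1 - f x) := by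
      refine intervalIntegral.integral_mono_interval h3 (by linarith [hr.1]) le_rfl ?_
        (hsub _ _ h1 h2 hr.2)
      filter_upwards [ae_restrict_mem measurableSet_Ioc] with x hx
      exact sub_nonneg.2 (hf1 x (h1.trans hx.1.le) (hx.2.trans hr.2))
    have hnn : 0 ≤ ∫ x in (lam * μ)..(lam * (μ + 1)), (1 - f x) :=
      intervalIntegral.integral_nonneg h2 fun x hx =>
        sub_nonneg.2 (hf1 x (h1.trans hx.1) (hx.2.trans hr.2))
    have hg := hgD _ hr
    beta_reduce at hg
    rw [hFsub _ _ (by linarith [hr.1]) (by linarith [hr.1]) hr.2] at hg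
    rw [hsplit, hdef]
    refine sub_le_sub_left (hg.trans ?_) 1
    rw [div_eq_inv_mul]
    calc _ ≤ (lam * (μ + 1))⁻¹ * ∫ x in (lam * μ)..(lam * (μ + 1)), (1 - f x) := by
          have := hr.1
          gcongr
      _ ≤ _ := by
          gcongr
          nlinarith [hμ.1]

/-! ### Scaling of the covariance and of `κ` -/

section Covariance

variable {Ω : Type*} [MeasurableSpace Ω] {P : Measure Ω} {S : Ω → C(I, ℝ)}

lemma covFun_mul_mul_of_identDistrib {α : ℝ} {r : I}
    (h : IdentDistrib (fun ω (x : I) => S ω (r * x)) (fun ω (x : I) => √(r : ℝ) ^ α * S ω x) P P)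
    (x y : I) : covFun S P (r * x) (r * y) = (√(r : ℝ) ^ α) ^ 2 * covFun S P x y := by
  have hm : Measurable fun p : I → ℝ => p x * p y := by fun_prop
  have := (h.comp hm).integral_eq
  simp only [Function.comp_def] at this
  rw [covFun, this, covFun, ← integral_const_mul]
  congr 1
  ext ω
  ring

end Covariance

section Kappa

variable {Γ : I → I → ℝ} {β : ℝ}

/-- Below `1/e` the iterated logarithm is positive, so its outer absolute value can be dropped. -/
lemma one_lt_abs_log {x : ℝ} (h0 : 0 < x) (h1 : x < Real.exp (-1)) : 1 < |Real.log x| := by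
  have := (Real.log_lt_iff_lt_exp h0).2 h1
  rw [lt_abs]
  right
  linarith

lemma kappa_continuousOn (hΓ : Continuous fun p : I × I => Γ p.1 p.2) :
    ContinuousOn (kappa Γ β) {x : I | 0 < (x : ℝ) ∧ (x : ℝ) < Real.exp (-1)} := by
  have hdiag : Continuous fun x : I => Γ x x :=
    hΓ.comp (continuous_id.prodMk continuous_id)
  unfold kappa
  refine continuousOn_const.mul (ContinuousOn.sqrt (hdiag.continuousOn.mul ?_))
  refine (ContinuousOn.log (ContinuousOn.abs (ContinuousOn.log (by fun_prop) ?_)) ?_).abs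
  · exact fun x hx => hx.1.ne'
  · exact fun x hx => (zero_lt_one.trans (one_lt_abs_log hx.1 hx.2)).ne'

lemma kappa_pos (hβ : 0 < β) {x : I} (hΓ : 0 < Γ x x) (h0 : 0 < (x : ℝ))
    (h1 : (x : ℝ) < Real.exp (-1)) : 0 < kappa Γ β x :=
  mul_pos hβ (Real.sqrt_pos.2 (mul_pos hΓ (abs_pos.2
    (Real.log_pos (one_lt_abs_log h0 h1)).ne')))

/-- The variance factors under scaling, and the iterated logarithm only grows towards 0. This
one-sided bound suffices; the limit of the ratio is not needed. -/
lemma sqrt_mul_kappa_le_kappa (hβ : 0 ≤ β) {r x : I} {c : ℝ} (hc : 0 ≤ c)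
    (hr : Γ r r = c) (hrx : Γ (r * x) (r * x) = c * Γ x x) (hΓx : 0 ≤ Γ x x)
    (h0 : 0 < (r : ℝ)) (h1 : (r : ℝ) < Real.exp (-1)) (hx : 0 < (x : ℝ)) :
    √(Γ x x) * kappa Γ β r ≤ kappa Γ β (r * x) := by
  have hlog : abs (Real.log (abs (Real.log (r : ℝ)))) ≤ abs (Real.log (abs (Real.log ((r * x : I) : ℝ)))) := by
    have hle : ((r * x : I) : ℝ) ≤ r := by
      push_cast
      exact mul_le_of_le_one_right h0.le x.2.2
    have hpos : 0 < ((r * x : I) : ℝ) := by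
      push_cast
      positivity
    have hl := Real.log_le_log hpos hle
    have hr1 := one_lt_abs_log h0 h1
    have hrx1 := one_lt_abs_log hpos (hle.trans_lt h1)
    have hneg : Real.log (r : ℝ) ≤ 0 := Real.log_nonpos h0.le r.2.2
    have hab : |Real.log (r : ℝ)| ≤ |Real.log ((r * x : I) : ℝ)| := by
      rw [abs_of_nonpos hneg, abs_of_nonpos (hl.trans hneg)]
      linarith
    rw [abs_of_pos (Real.log_pos hr1), abs_of_pos (Real.log_pos hrx1)]
    exact Real.log_le_log (by linarith) hab
  unfold kappa
  rw [mul_left_comm, ← Real.sqrt_mul hΓx, hr, hrx]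
  gcongr β * √?_
  calc Γ x x * (c * abs (Real.log (abs (Real.log (r : ℝ)))))
      = c * Γ x x * abs (Real.log (abs (Real.log (r : ℝ)))) := by ring
    _ ≤ _ := by gcongr

end Kappa

/-! ### Limit points of the rescaled paths -/

/-- A cluster point of a family of continuous functions inherits eventual lower bounds. -/
lemma MapClusterPt.le_apply {ι X : Type*} [TopologicalSpace X] [CompactSpace X]
    {l : Filter ι} {u : ι → C(X, ℝ)} {φ : C(X, ℝ)}
    (h : MapClusterPt φ l u) {x : X} {a : ℝ} (ha : ∀ᶠ i in l, a ≤ u i x) : a ≤ φ x := by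
  have h' : MapClusterPt (φ x) l ((fun f : C(X, ℝ) => f x) ∘ u) :=
    h.continuousAt_comp (continuous_eval_const x).continuousAt
  exact isClosed_Ici.mem_of_mapClusterPt h' ha

/-- If the limit points of the rescaled paths of `s` lie in the unit ball of the reproducing
kernel Hilbert space, then `s` cannot exceed `κ` at both `r` and `r x` for small `r`. -/
lemma eventually_not_kappa_le {Γ : I → I → ℝ} {hΓ : (kernelMatrix Γ).PosSemidef} {β : ℝ}
    (hβ : 0 < β) {s : C(I, ℝ)} {K : Set C(I, ℝ)} (hK : IsCompact K)
    (hmem : ∀ᶠ r in 𝓝[>] (0 : I), rescaledPath Γ β s r ∈ K)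
    (hclus : ∀ φ, MapClusterPt φ (𝓝[>] (0 : I)) (rescaledPath Γ β s) → φ ∈ rkhsUnitBall Γ hΓ)
    {x : I} (hx : 0 < x) (hone : Γ 1 1 = 1)
    (hscale : ∀ r : I, 0 < r → Γ (r * x) (r * x) = Γ r r * Γ x x)
    (hpos : ∀ r : I, 0 < r → 0 < Γ r r)
    (hdet : Γ 1 1 * Γ x x ≠ Γ 1 x * Γ x 1) :
    ∀ᶠ r in 𝓝[>] (0 : I), ¬ (kappa Γ β r ≤ s r ∧ kappa Γ β (r * x) ≤ s (r * x)) := by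
  by_contra hcon
  -- Restricting the filter to `A` gives a cluster point that inherits both inequalities and is
  -- still a limit point of the whole family.
  set A := {r : I | kappa Γ β r ≤ s r ∧ kappa Γ β (r * x) ≤ s (r * x)} with hA
  have hne : (𝓝[>] (0 : I) ⊓ 𝓟 A).NeBot := by
    rw [← frequently_mem_iff_neBot]
    exact fun h => hcon h
  obtain ⟨φ, -, hφ⟩ := hK.exists_mapClusterPt (f := 𝓝[>] (0 : I) ⊓ 𝓟 A)
    (u := rescaledPath Γ β s) (le_principal_iff.2 (mem_map.2 (mem_inf_of_left hmem)))
  have hball := hclus φ (hφ.mono inf_le_left)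
  have hsmall : ∀ᶠ r in 𝓝[>] (0 : I) ⊓ 𝓟 A, r ∈ A ∧ 0 < r ∧ (r : ℝ) < Real.exp (-1) := by
    have h1 : ∀ᶠ r : I in 𝓝[>] (0 : I), ((r : I) : ℝ) < Real.exp (-1) :=
      nhdsWithin_le_nhds (continuous_subtype_val.tendsto' (0 : I) 0 rfl
        |>.eventually_lt_const (Real.exp_pos (-1)))
    have h2 : ∀ᶠ r in 𝓝[>] (0 : I), 0 < r := self_mem_nhdsWithin
    filter_upwards [mem_inf_of_left h1, mem_inf_of_left h2, mem_inf_of_right (mem_principal_self A)]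
      with r h1 h2 h3 using ⟨h3, h2, h1⟩
  refine hdet (mul_eq_mul_of_mem_rkhsUnitBall hball ?_ ?_)
  · refine hφ.le_apply ?_
    filter_upwards [hsmall] with r ⟨hrA, hr0, hr1⟩
    have hκ := kappa_pos hβ (hpos r hr0) hr0 hr1
    simp only [rescaledPath, ContinuousMap.coe_mk, hone, Real.sqrt_one, mul_one]
    exact (one_le_div hκ).2 hrA.1
  · refine hφ.le_apply ?_
    filter_upwards [hsmall] with r ⟨hrA, hr0, hr1⟩
    have hκ := kappa_pos hβ (hpos r hr0) hr0 hr1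
    simp only [rescaledPath, ContinuousMap.coe_mk]
    rw [le_div_iff₀ hκ]
    exact (sqrt_mul_kappa_le_kappa hβ.le (hpos r hr0).le rfl (hscale r hr0) (hpos x hx).le
      hr0 hr1 hx).trans hrA.2

/-! ### The path density and the conclusion -/

lemma pathDensity_of_mem {κ : I → ℝ} {s : C(I, ℝ)} {f₀ : ℝ → ℝ} {x : ℝ} (hx : x ∈ Icc (0 : ℝ) 1) :
    pathDensity κ s f₀ x = min (max (1 + s ⟨x, hx⟩ - κ ⟨x, hx⟩) 0) 1 :=
  dif_pos hx

lemma pathDensity_le_one {κ : I → ℝ} {s : C(I, ℝ)} {f₀ : ℝ → ℝ}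
    (hf₀ : ∀ x, 1 < x → f₀ x ∈ Icc (0 : ℝ) 1) {x : ℝ} (hx : 0 ≤ x) :
    pathDensity κ s f₀ x ≤ 1 := by
  by_cases h : x ≤ 1
  · rw [pathDensity_of_mem ⟨hx, h⟩]
    exact min_le_right _ _
  · rw [pathDensity, dif_neg fun h' => h h'.2]
    exact (hf₀ x (not_le.1 h)).2

lemma pathDensity_continuousOn {κ : I → ℝ} {s : C(I, ℝ)} {f₀ : ℝ → ℝ} {a : ℝ} (ha : a ≤ 1)
    (hκ : ContinuousOn κ {x : I | 0 < (x : ℝ) ∧ (x : ℝ) ≤ a}) :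
    ContinuousOn (pathDensity κ s f₀) (Ioc 0 a) := by
  have hmem : ∀ x ∈ Ioc 0 a, x ∈ Icc (0 : ℝ) 1 := fun x hx => ⟨hx.1.le, hx.2.trans ha⟩
  have hc : ContinuousOn
      (fun x => min (max (1 + s (projIcc 0 1 zero_le_one x) - κ (projIcc 0 1 zero_le_one x)) 0) 1)
      (Ioc 0 a) := by
    refine ContinuousOn.inf (ContinuousOn.sup (ContinuousOn.sub (Continuous.continuousOn ?_)
      (hκ.comp continuous_projIcc.continuousOn fun x hx => ?_)) continuousOn_const)
      continuousOn_const
    · exact continuous_const.add (s.continuous.comp continuous_projIcc)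
    · rw [projIcc_of_mem _ (hmem x hx)]
      exact hx
  refine hc.congr fun x hx => ?_
  simp only [pathDensity_of_mem (hmem x hx), projIcc_of_mem _ (hmem x hx)]

lemma pathDensity_lt_one {κ : I → ℝ} {s : C(I, ℝ)} {f₀ : ℝ → ℝ} {x : I} (h : s x < κ x) :
    pathDensity κ s f₀ x < 1 := by
  rw [pathDensity_of_mem x.2]
  exact min_lt_of_left_lt (max_lt (by simp only [Subtype.coe_eta]; linarith) one_pos)

/-- The averaging condition holds as soon as `s` does not exceed `κ` at both `r` and `r / 2`
for small `r`. -/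
lemma averagingCondition_pathDensity {κ : I → ℝ} {s : C(I, ℝ)} {f₀ : ℝ → ℝ} {half : I}
    (hhalf : (half : ℝ) = 1 / 2) {a : ℝ} (ha : 0 < a)
    (hκ : ContinuousOn κ {x : I | 0 < (x : ℝ) ∧ (x : ℝ) < a})
    (hs : ∀ᶠ r in 𝓝[>] (0 : I), ¬ (κ r ≤ s r ∧ κ (r * half) ≤ s (r * half)))
    (hf₀ : ∀ x, 1 < x → f₀ x ∈ Icc (0 : ℝ) 1)
    (hint : IntegrableOn (fun x => x * pathDensity κ s f₀ x) (Ioi 0)) :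
    AveragingCondition (pathDensity κ s f₀) := by
  obtain ⟨ε, hε, hεs⟩ := (mem_nhdsGT_iff_exists_Ioo_subset' (zero_lt_one (α := I))).1 hs
  have hε0 : 0 < (ε : ℝ) := hε
  set R : ℝ := min (ε / 2) (a / 2)
  have hR : 0 < R := lt_min (by linarith) (by linarith)
  have hRε : R < ε := (min_le_left _ _).trans_lt (by linarith)
  have hRa : R < a := (min_le_right _ _).trans_lt (by linarith)
  have hR1 : R ≤ 1 := hRε.le.trans ε.2.2
  obtain ⟨g, hgm, hgp, hg0, hg⟩ := exists_average_le_one_sub (f := pathDensity κ s f₀) hR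
    (pathDensity_continuousOn hR1 (hκ.mono fun x hx => ⟨hx.1, hx.2.trans_lt hRa⟩))
    (fun x h0 h1 => by
      rw [pathDensity_of_mem ⟨h0, h1.trans hR1⟩]
      exact le_min (le_max_right _ _) zero_le_one)
    (fun x h0 _ => pathDensity_le_one hf₀ h0)
    (fun r hr => by
      set r' : I := ⟨r, hr.1.le, hr.2.trans hR1⟩ with hr'
      have hnot := hεs (show r' ∈ Ioo 0 ε from ⟨hr.1, hr.2.trans_lt hRε⟩)
      have hcoe : ((r' * half : I) : ℝ) = r / 2 := by
        push_cast
        rw [hhalf, hr']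
        ring
      rcases not_and_or.1 hnot with h | h
      · exact ⟨r, ⟨by linarith [hr.1], le_rfl⟩, pathDensity_lt_one (x := r') (not_le.1 h)⟩
      · refine ⟨r / 2, ⟨le_rfl, by linarith [hr.1]⟩, ?_⟩
        rw [← hcoe]
        exact pathDensity_lt_one (not_le.1 h))
  exact ⟨g, hgm, hgp, hg0, fun x hx => pathDensity_le_one hf₀ hx, hint, R / 2, by linarith, hg⟩

theorem proposition3p1 {Ω : Type*} [MeasurableSpace Ω] (P : Measure Ω) [IsProbabilityMeasure P]
    (S : Ω → C(I, ℝ))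
    (hmeas : ∀ x : I, Measurable fun ω => S ω x)
    (hgauss : IsGaussianProcess (fun x ω => S ω x) P)
    (hcentered : ∀ x : I, ∫ ω, S ω x ∂P = 0)
    (hzero : ∀ ω, S ω 0 = 0)
    (hcovcont : Continuous fun p : I × I => covFun S P p.1 p.2)
    (hnondeg : ∀ x y : I, 0 < x → 0 < y → x ≠ y →
      (!![covFun S P x x, covFun S P x y; covFun S P y x, covFun S P y y] :
        Matrix (Fin 2) (Fin 2) ℝ).det ≠ 0)
    (α₂ : ℝ) (hα₂ : 0 < α₂)
    (hscaling : ∀ r : I, 0 < r →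
      IdentDistrib (fun ω (x : I) => S ω (r * x)) (fun ω (x : I) => √(r : ℝ) ^ α₂ * S ω x) P P)
    (hnorm : covFun S P 1 1 = 1)
    (β : ℝ) (hβ : 0 < β)
    (hLIL : LocalFunctionalLIL S P hgauss β) :
    ∀ᵐ ω ∂P, ∀ f₀ : ℝ → ℝ,
      (∀ x, 1 < x → f₀ x ∈ Icc (0 : ℝ) 1) →
      ∫ x in Ioi (0 : ℝ), pathDensity (kappa (covFun S P) β) (S ω) f₀ x = 1 →
      IntegrableOn (fun x => x * pathDensity (kappa (covFun S P) β) (S ω) f₀ x) (Ioi 0) →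
      AveragingCondition (pathDensity (kappa (covFun S P) β) (S ω) f₀) := by
  set Γ := covFun S P with hΓdef
  have hscale : ∀ r x : I, 0 < r → Γ (r * x) (r * x) = Γ r r * Γ x x := fun r x hr => by
    have h1 := covFun_mul_mul_of_identDistrib (hscaling r hr) 1 1
    have h2 := covFun_mul_mul_of_identDistrib (hscaling r hr) x x
    rw [mul_one, ← hΓdef, hnorm, mul_one] at h1
    rw [h1, ← h2]
  have hpos : ∀ r : I, 0 < r → 0 < Γ r r := fun r hr => by
    have h1 := covFun_mul_mul_of_identDistrib (hscaling r hr) 1 1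
    rw [mul_one, ← hΓdef, hnorm, mul_one] at h1
    have hr' : (0 : ℝ) < r := hr
    rw [h1]
    positivity
  -- The ratio `1/2` is that of the endpoints of the shortest window relative to `r`, at `μ = 1`.
  let half : I := ⟨1 / 2, by norm_num, by norm_num⟩
  have hhalf : 0 < half := show (0 : ℝ) < 1 / 2 by norm_num
  have hne : (1 : I) ≠ half := fun h => by
    have : (1 : ℝ) = 1 / 2 := congrArg Subtype.val h
    norm_num at this
  have hdet := hnondeg 1 half zero_lt_one hhalf hne
  rw [Matrix.det_fin_two_of, sub_ne_zero] at hdet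
  filter_upwards [hLIL] with ω ⟨⟨r₀, hr₀, hcomp⟩, hclus⟩ f₀ hf₀ _ hint
  refine averagingCondition_pathDensity (half := half) rfl (Real.exp_pos (-1))
    (kappa_continuousOn hcovcont) ?_ hf₀ hint
  refine eventually_not_kappa_le hβ hcomp ?_ (fun φ hφ => hclus.subset hφ) hhalf hnorm
    (fun r hr => hscale r half hr) hpos hdet
  filter_upwards [Ioc_mem_nhdsGT hr₀] with r hr
  exact subset_closure (mem_image_of_mem _ hr)
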